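/- Let $p$ be a prime, let $k$ be an algebraically closed field of characteristic $p$, and let $G$ be a finite $p$-solvable group, i.e. a finite group each of whose composition factors has order $p$ or order prime to $p$. Let $V$ be a finite-dimensional irreducible $kG$-module on which $G$ acts faithfully, given by $\rho : G \to \mathrm{GL}(V)$. Assume that one of the following holds: 1. $p > \dim V$ and $p$ is not a Fermat prime (a prime of the form $2^{2^m}+1$ with $m \ge 0$); 2. $p > \dim V + 1$. Then $(G,V)$ is adequate, that is: - $H^1(G,k) = 0$, where $G$ acts trivially on $k$; - $p$ does not divide $\dim V$; - $H^1(G, V \otimes V^*) = 0$; - $\operatorname{End}_k(V)$ is spanned over $k$ by the elements $\rho(g)$, $g \in G$, that are semisimple. Moreover, $p$ does not divide $|G|$. -/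

import Mathlib

universe u

/-- A (finite) group `G` is `p`-solvable if every composition factor of `G` has order `p` or order
prime to `p`. The composition factors of a finite group are the simple quotients `H ⧸ K`, where `H`
is subnormal in `G` and `K` is normal in `H`: every such pair is a step of a composition series,
and every step of a composition series is such a pair. -/
def IsPSolvable (p : ℕ) (G : Type*) [Group G] : Prop :=
  ∀ H : Subgroup G, H.IsSubnormal → ∀ (K : Subgroup H) [K.Normal], IsSimpleGroup (H ⧸ K) →
    Nat.card (H ⧸ K) = p ∨ (Nat.card (H ⧸ K)).Coprime p

/-- Adequacy of `(G, V)`, where `V` is a `kG`-module given by `ρ` and `p` is the characteristic of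
`k`. It is meant for finite-dimensional absolutely irreducible `V` (over an algebraically closed
field: for finite-dimensional irreducible `V`). -/
structure Representation.IsAdequate (p : ℕ) {k G V : Type u} [Field k] [Group G]
    [AddCommGroup V] [Module k V] (ρ : Representation k G V) : Prop where
  /-- `H¹(G, k) = 0`, for the trivial action of `G` on `k`. -/
  H1_trivial : Subsingleton (groupCohomology.H1 (Rep.of (Representation.trivial k G k)))
  /-- `p` does not divide `dim V`. -/
  not_dvd_finrank : ¬ p ∣ Module.finrank k V
  /-- `H¹(G, V ⊗ V*) = 0`, for the diagonal action of `G`. -/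
  H1_tprod_dual : Subsingleton (groupCohomology.H1 (Rep.of (ρ.tprod ρ.dual)))
  /-- `End(V)` is spanned by the elements `ρ(g)` with `ρ(g)` semisimple. -/
  span_semisimple :
    Submodule.span k {f : Module.End k V | f.IsSemisimple ∧ ∃ g : G, ρ g = f} = ⊤

/-! The point is that $p \nmid |G|$. Then every $\rho(g)$ is semisimple, Burnside's theorem gives
the spanning condition, and averaging kills the cohomology.

Suppose $p$ divides $|G|$. A normal $p$-subgroup has a nonzero fixed vector, so by irreducibility
and faithfulness it is trivial. The Hall-Higman lemma
`IsPSolvable.exists_normal_not_dvd_card_centralizer` then provides an element of order $p$ acting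
nontrivially by conjugation on a normal $p'$-subgroup. Let $Q$ be a minimal invariant subgroup of it
on which the action is nontrivial. It is not abelian, since fewer than $p$ characters occur in $V$.
Minimality makes $Q$ a $q$-group with $[Q,Q] \le Z(Q)$ and with no nontrivial fixed points on
$Q/Z(Q)$, whence $|Q:Z(Q)| \equiv 1 \pmod p$. A suitable irreducible constituent of $V|_Q$ has
degree $m$ with $m^2 = |Q:Z(Q)|$ and $1 < m < p$, so $p = m + 1$ with $m$ a power of $q$. This
contradicts $p > \dim V + 1$, and it makes $p$ a Fermat prime. -/

/-! ### $p$-solvable groups and the Hall-Higman lemma -/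

theorem IsPSolvable.card_of_surjective {p : ℕ} {G S : Type*} [Group G] [Group S]
    (h : IsPSolvable p G) {H : Subgroup G} (hH : H.IsSubnormal) [IsSimpleGroup S]
    (f : H →* S) (hf : Function.Surjective f) :
    Nat.card S = p ∨ (Nat.card S).Coprime p := by
  let e := QuotientGroup.quotientKerEquivOfSurjective f hf
  rw [← Nat.card_congr e.toEquiv]
  exact h H hH f.ker e.isSimpleGroup

theorem IsPSolvable.of_isSubnormal {p : ℕ} {G : Type*} [Group G] (h : IsPSolvable p G)
    {N : Subgroup G} (hN : N.IsSubnormal) : IsPSolvable p N := by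
  intro H hH K _ hs
  let e : H ≃* H.map N.subtype := H.equivMapOfInjective _ N.subtype_injective
  exact h.card_of_surjective (hH.trans' hN) ((QuotientGroup.mk' K).comp e.symm.toMonoidHom)
    ((QuotientGroup.mk'_surjective K).comp e.symm.surjective)

theorem IsPSolvable.quotient {p : ℕ} {G : Type*} [Group G] (h : IsPSolvable p G)
    (N : Subgroup G) [N.Normal] : IsPSolvable p (G ⧸ N) := by
  intro H hH K _ hs
  exact h.card_of_surjective (hH.comap (QuotientGroup.mk' N))
    ((QuotientGroup.mk' K).comp ((QuotientGroup.mk' N).subgroupComap H))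
    ((QuotientGroup.mk'_surjective K).comp
      (MonoidHom.subgroupComap_surjective_of_surjective _ _ (QuotientGroup.mk'_surjective N)))

theorem Subgroup.card_sup_dvd_of_normal {G : Type*} [Group G] [Finite G] (M N : Subgroup G)
    [N.Normal] : Nat.card (M ⊔ N : Subgroup G) ∣ Nat.card M * Nat.card N := by
  rw [← Subgroup.card_mul_index (N.subgroupOf (M ⊔ N)), mul_comm (Nat.card M)]
  apply mul_dvd_mul
  · rw [Nat.card_congr (Subgroup.subgroupOfEquivOfLe le_sup_right).toEquiv]
  · change N.relIndex (M ⊔ N) ∣ _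
    rw [Subgroup.relIndex_sup_right]
    exact Subgroup.relIndex_dvd_card _ _

/-- The order of a product of two normal subgroups divides the product of their orders, so a maximal
one is the greatest, hence characteristic. This yields $O_p(G)$ and $O_{p'}(G)$. -/
theorem Subgroup.exists_greatest_normal {G : Type*} [Group G] [Finite G] {S : ℕ → Prop}
    (one : S 1) (mul : ∀ a b, S a → S b → S (a * b)) (dvd : ∀ a b, a ∣ b → S b → S a) :
    ∃ N : Subgroup G, N.Characteristic ∧ S (Nat.card N) ∧
      ∀ M : Subgroup G, M.Normal → S (Nat.card M) → M ≤ N := by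
  obtain ⟨N, ⟨hN, hS⟩, hmax⟩ := (Set.toFinite {N : Subgroup G | N.Normal ∧ S (Nat.card N)}).exists_maximal
    ⟨⊥, inferInstance, by simpa using one⟩
  have key : ∀ M : Subgroup G, M.Normal → S (Nat.card M) → M ≤ N := by
    intro M hM hSM
    have := @hmax (M ⊔ N) ⟨inferInstance, dvd _ _ (card_sup_dvd_of_normal M N) (mul _ _ hSM hS)⟩
      le_sup_right
    exact le_sup_left.trans this
  refine ⟨N, ?_, hS, key⟩
  rw [Subgroup.characteristic_iff_map_le]
  intro φ
  refine key _ (hN.map _ φ.surjective) ?_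
  rwa [← Nat.card_congr (N.equivMapOfInjective φ.toMonoidHom φ.injective).toEquiv]

/-- A nontrivial finite `p`-solvable group has a nontrivial characteristic subgroup which is
either a `p`-group or a `p'`-group. -/
theorem IsPSolvable.exists_characteristic {p : ℕ} [Fact p.Prime] :
    ∀ (n : ℕ) {G : Type*} [Group G] [Finite G] [Nontrivial G], Nat.card G = n → IsPSolvable p G →
    ∃ N : Subgroup G, N.Characteristic ∧ N ≠ ⊥ ∧
      ((∃ a, Nat.card N = p ^ a) ∨ (Nat.card N).Coprime p) := by
  intro n
  induction n using Nat.strong_induction_on with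
  | _ n ih =>
  intro G _ _ _ hn h
  have hp : p.Prime := Fact.out
  suffices hs : ∃ N : Subgroup G, N.Normal ∧ N ≠ ⊥ ∧
      ((∃ a, Nat.card N = p ^ a) ∨ (Nat.card N).Coprime p) by
    obtain ⟨N, hN, hbot, hc⟩ := hs
    rcases hc with hc | hc
    · obtain ⟨M, hM, hS, hmax⟩ := Subgroup.exists_greatest_normal (G := G)
        (S := fun m => ∃ a, m = p ^ a) ⟨0, by simp⟩
        (by rintro _ _ ⟨a, rfl⟩ ⟨b, rfl⟩; exact ⟨a + b, (pow_add _ _ _).symm⟩)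
        (by rintro a _ hab ⟨b, rfl⟩
            obtain ⟨c, -, hc⟩ := (Nat.dvd_prime_pow hp).1 hab
            exact ⟨c, hc⟩)
      exact ⟨M, hM, fun hb => hbot (le_bot_iff.1 (hb ▸ hmax N hN hc)), .inl hS⟩
    · obtain ⟨M, hM, hS, hmax⟩ := Subgroup.exists_greatest_normal (G := G)
        (S := fun m => m.Coprime p) (by simp) (fun a b => Nat.Coprime.mul_left)
        (fun a b hab hb => hb.coprime_dvd_left hab)
      exact ⟨M, hM, fun hb => hbot (le_bot_iff.1 (hb ▸ hmax N hN hc)), .inr hS⟩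
  -- If a maximal proper normal subgroup $K$ is trivial, $G$ is simple. Otherwise induction applies
  -- to $K$, and characteristic subgroups of $K$ are normal in $G$.
  obtain ⟨K, ⟨hK, hKtop⟩, hmax⟩ := (Set.toFinite {N : Subgroup G | N.Normal ∧ N ≠ ⊤}).exists_maximal
    ⟨⊥, inferInstance, bot_ne_top⟩
  by_cases hKbot : K = ⊥
  · have hsimple : IsSimpleGroup G := ⟨fun H hH => by
      by_cases ht : H = ⊤
      · exact .inr ht
      · exact .inl (le_bot_iff.1 (hKbot ▸ hmax ⟨hH, ht⟩ (by simp [hKbot])))⟩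
    refine ⟨⊤, inferInstance, top_ne_bot, ?_⟩
    rw [Subgroup.card_top]
    have := h.card_of_surjective Subgroup.IsSubnormal.top (S := G)
      (Subgroup.topEquiv (G := G)).toMonoidHom Subgroup.topEquiv.surjective
    exact this.imp (fun h => ⟨1, by simpa using h⟩) id
  · have hlt : Nat.card K < n := by
      rw [← hn]
      refine lt_of_le_of_ne (Subgroup.card_le_card_group K) fun he => hKtop ?_
      exact Subgroup.eq_top_of_card_eq _ he
    have : Nontrivial K := (Subgroup.nontrivial_iff_ne_bot K).2 hKbot
    obtain ⟨R, hR, hRbot, hRc⟩ := ih _ hlt rfl (h.of_isSubnormal hK.isSubnormal)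
    refine ⟨R.map K.subtype, inferInstance, ?_, ?_⟩
    · rwa [Ne, Subgroup.map_eq_bot_iff_of_injective _ K.subtype_injective]
    · rwa [← Nat.card_congr (R.equivMapOfInjective K.subtype K.subtype_injective).toEquiv]

/-- A form of the Hall-Higman lemma: if `O_p(G) = 1`, then the centralizer of `O_{p'}(G)` is a
`p'`-group. -/
theorem IsPSolvable.exists_normal_not_dvd_card_centralizer {p : ℕ} [Fact p.Prime] {G : Type*}
    [Group G] [Finite G] (h : IsPSolvable p G)
    (hO : ∀ P : Subgroup G, P.Normal → IsPGroup p P → P = ⊥) :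
    ∃ N : Subgroup G, N.Normal ∧ (Nat.card N).Coprime p ∧
      ¬ p ∣ Nat.card (Subgroup.centralizer (N : Set G)) := by
  have hp : p.Prime := Fact.out
  obtain ⟨N, hN, hNc, hmax⟩ := Subgroup.exists_greatest_normal (G := G)
    (S := fun m => m.Coprime p) (by simp) (fun a b => Nat.Coprime.mul_left)
    (fun a b hab hb => hb.coprime_dvd_left hab)
  refine ⟨N, inferInstance, hNc, fun hdvd => ?_⟩
  set C := Subgroup.centralizer (N : Set G) with hC
  let π := QuotientGroup.mk' N
  have hπ : Function.Surjective π := QuotientGroup.mk'_surjective N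
  have hCn : C.Normal := inferInstance
  have hCb : (C.map π).Normal := hCn.map π hπ
  have hCbot : C.map π ≠ ⊥ := by
    intro hb
    rw [Subgroup.map_eq_bot_iff, QuotientGroup.ker_mk'] at hb
    have := hNc.coprime_dvd_left (Subgroup.card_dvd_of_le hb)
    exact hp.coprime_iff_not_dvd.1 this.symm hdvd
  have : Nontrivial (C.map π) := (Subgroup.nontrivial_iff_ne_bot _).2 hCbot
  obtain ⟨R, hR, hRbot, hRc⟩ :=
    IsPSolvable.exists_characteristic _ rfl ((h.quotient N).of_isSubnormal hCb.isSubnormal)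
  set M := R.map (C.map π).subtype with hM
  have hMn : M.Normal := inferInstance
  have hMbot : M ≠ ⊥ := by
    rwa [hM, Ne, Subgroup.map_eq_bot_iff_of_injective _ (Subgroup.subtype_injective _)]
  have hRM : Nat.card R = Nat.card M :=
    Nat.card_congr (R.equivMapOfInjective _ (Subgroup.subtype_injective _)).toEquiv
  rw [hRM] at hRc
  -- $D$ centralizes $N$, so $D \cap N$ is central in $D$; and $D/(D \cap N) \cong M$.
  set D := M.comap π ⊓ C with hD
  have hDn : D.Normal := by
    have := hMn.comap π
    infer_instance
  have hDM : D.map π = M := by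
    apply le_antisymm
    · exact (Subgroup.map_mono inf_le_left).trans (Subgroup.map_comap_le _ _)
    · intro x hx
      obtain ⟨c, hc, rfl⟩ := (Subgroup.map_subtype_le R : M ≤ C.map π) hx
      exact ⟨c, ⟨hx, hc⟩, rfl⟩
  have hindex : (N.subgroupOf D).index = Nat.card M := by
    have := Subgroup.relIndex_ker (K := D) π
    rwa [QuotientGroup.ker_mk', hDM] at this
  have hK : (Nat.card (N.subgroupOf D)).Coprime p := by
    exact hNc.coprime_dvd_left
      (Subgroup.card_comap_dvd_of_injective N D.subtype D.subtype_injective)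
  rcases hRc with ⟨a, ha⟩ | hcop
  -- Here $D = P(D \cap N)$ with $D \cap N$ central, so $P$ is normal, hence characteristic, in $D$:
  -- a nontrivial normal $p$-subgroup of $G$.
  · let P : Sylow p D := default
    have htop : (P : Subgroup D) ⊔ N.subgroupOf D = ⊤ := by
      rw [← Subgroup.index_eq_one]
      have h1 := Subgroup.index_dvd_of_le (le_sup_left : (P : Subgroup D) ≤ (P : Subgroup D) ⊔ N.subgroupOf D)
      have h2 := Subgroup.index_dvd_of_le (le_sup_right : N.subgroupOf D ≤ (P : Subgroup D) ⊔ N.subgroupOf D)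
      rw [hindex, ha] at h2
      have h3 : ((P : Subgroup D) ⊔ N.subgroupOf D).index.Coprime p := by
        rw [Nat.coprime_comm, hp.coprime_iff_not_dvd]
        exact fun h => P.not_dvd_index (h.trans h1)
      exact Nat.Coprime.eq_one_of_dvd (h3.pow_right a) h2
    have hPn : (P : Subgroup D).Normal := by
      rw [← Subgroup.normalizer_eq_top_iff, ← top_le_iff, ← htop]
      refine sup_le Subgroup.le_normalizer ?_
      intro x hx
      rw [Subgroup.mem_normalizer_iff]
      intro y
      have : x * y * x⁻¹ = y := by
        rw [mul_inv_eq_iff_eq_mul]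
        exact Subtype.ext ((Subgroup.mem_centralizer_iff.1 y.2.2) _ hx)
      rw [this]
    have := P.characteristic_of_normal hPn
    have hP := hO ((P : Subgroup D).map D.subtype) inferInstance (P.isPGroup'.map _)
    rw [Subgroup.map_eq_bot_iff_of_injective _ D.subtype_injective] at hP
    refine P.ne_bot_of_dvd_card ?_ hP
    have hpM : p ∣ Nat.card M := by
      rw [ha]
      refine dvd_pow_self p fun h0 => hMbot ?_
      rw [h0, pow_zero] at ha
      exact Subgroup.card_eq_one.1 ha
    rw [← hindex] at hpM
    exact hpM.trans (Subgroup.index_dvd_card _)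
  -- Now $D$ is a normal $p'$-subgroup, so $D \le N$ and its image $M$ is trivial.
  · refine hMbot ?_
    rw [← hDM, Subgroup.map_eq_bot_iff, QuotientGroup.ker_mk']
    refine hmax D hDn ?_
    rw [← Subgroup.card_mul_index (N.subgroupOf D), hindex]
    exact hK.mul_left hcop

/-! ### Coprime automorphisms that are trivial on every proper invariant subgroup -/

section CoprimeAut

/-- With $c = x^{-1}\varphi(x)$ fixed, $\varphi^n(x) = xc^n$. Thus $c^p = 1$, and $c = 1$ by
coprimality. -/
theorem MulAut.apply_eq_self_of_fixed_inv_mul {p : ℕ} {Q : Type*} [Group Q] {φ : MulAut Q} (hφ : φ ^ p = 1) (hQ : (Nat.card Q).Coprime p)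
    {x : Q} (hx : φ (x⁻¹ * φ x) = x⁻¹ * φ x) : φ x = x := by
  set c := x⁻¹ * φ x with hc
  have h : ∀ n : ℕ, (φ ^ n) x = x * c ^ n := by
    intro n
    induction n with
    | zero => simp
    | succ n ih =>
      rw [pow_succ', MulAut.mul_apply, ih, map_mul, map_pow, hx, pow_succ', ← mul_assoc x, hc,
        mul_inv_cancel_left]
  have h1 : c ^ p = 1 := by simpa [hφ] using (h p).symm
  have h2 : c = 1 := by
    rw [← orderOf_eq_one_iff]
    exact Nat.Coprime.eq_one_of_dvd (hQ.coprime_dvd_left (orderOf_dvd_natCard c))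
      (orderOf_dvd_of_pow_eq_one h1)
  exact (inv_mul_eq_one.1 h2).symm

variable {p : ℕ} {Q : Type*} [Group Q] {φ : MulAut Q} (hφ : φ ^ p = 1) (hφ1 : φ ≠ 1) (hQ : (Nat.card Q).Coprime p)
  (hmin : ∀ H : Subgroup Q, H ≠ ⊤ → (∀ x ∈ H, φ x ∈ H) → ∀ x ∈ H, φ x = x)

include hφ hφ1 hQ hmin

/-- The number of Sylow $q$-subgroups is prime to $p$, so one of them is invariant. If none is all
of $Q$, minimality puts a Sylow subgroup for each $q$ inside the fixed subgroup, which is then $Q$.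
-/
theorem MulAut.exists_isPGroup_of_minimal [Finite Q] [Fact p.Prime] : ∃ q : ℕ, q.Prime ∧ IsPGroup q Q := by
  have hp : p.Prime := Fact.out
  by_contra! hcon
  let F : Subgroup Q := φ.toMonoidHom.eqLocus (MonoidHom.id Q)
  have hF : F = ⊤ := by
    rw [← Subgroup.index_eq_one]
    by_contra hne
    obtain ⟨q, hq, hqF⟩ := Nat.exists_prime_and_dvd hne
    have := Fact.mk hq
    have : Fintype (Sylow q Q) := Fintype.ofFinite _
    let σ : Equiv.Perm (Sylow q Q) := MulAction.toPermHom (MulAut Q) (Sylow q Q) φ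
    have hσ : σ ^ p ^ 1 = 1 := by rw [pow_one, ← map_pow, hφ, map_one]
    have hcard : ¬ p ∣ Fintype.card (Sylow q Q) := by
      rw [← Nat.card_eq_fintype_card, ← hp.coprime_iff_not_dvd, Nat.coprime_comm]
      let P : Sylow q Q := default
      exact hQ.coprime_dvd_left (P.card_dvd_index.trans (Subgroup.index_dvd_card _))
    obtain ⟨P, hP⟩ := Equiv.Perm.exists_fixed_point_of_prime hcard hσ
    have hPinv : ∀ x ∈ (P : Subgroup Q), φ x ∈ (P : Subgroup Q) := by
      intro x hx
      have h1 : ((φ • P : Sylow q Q) : Subgroup Q) = P := congrArg _ hP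
      rw [← h1]
      exact ⟨x, hx, rfl⟩
    have hPtop : (P : Subgroup Q) ≠ ⊤ := by
      intro ht
      have h1 := P.isPGroup'
      rw [ht] at h1
      exact hcon q hq (h1.of_equiv Subgroup.topEquiv)
    have hPF : (P : Subgroup Q) ≤ F := fun x hx => hmin P hPtop hPinv x hx
    exact P.not_dvd_index (hqF.trans (Subgroup.index_dvd_of_le hPF))
  refine hφ1 (MulEquiv.ext fun x => ?_)
  have : x ∈ F := hF ▸ Subgroup.mem_top x
  exact this

theorem MulAut.closure_inv_mul_eq_top_of_minimal :
    Subgroup.closure (Set.range fun x => x⁻¹ * φ x) = ⊤ := by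
  by_contra hne
  refine hφ1 (MulEquiv.ext fun x => apply_eq_self_of_fixed_inv_mul hφ hQ ?_)
  refine hmin _ hne ?_ _ (Subgroup.subset_closure ⟨x, rfl⟩)
  intro y hy
  have h1 : Subgroup.closure (Set.range fun x => x⁻¹ * φ x) ≤
      (Subgroup.closure (Set.range fun x => x⁻¹ * φ x)).comap φ.toMonoidHom := by
    rw [Subgroup.closure_le]
    rintro _ ⟨z, rfl⟩
    exact Subgroup.subset_closure ⟨φ z, by simp⟩
  exact h1 hy

/-- $\varphi$ fixes both $d$ and $xdx^{-1}$, so $d$ commutes with $x^{-1}\varphi(x)$; these elements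
generate $Q$. -/
theorem MulAut.le_center_of_minimal {D : Subgroup Q} [D.Normal] (hD : D ≠ ⊤)
    (hinv : ∀ x ∈ D, φ x ∈ D) : D ≤ Subgroup.center Q := by
  have hfix := hmin D hD hinv
  intro d hd
  have h1 : Subgroup.closure (Set.range fun x => x⁻¹ * φ x) ≤ Subgroup.centralizer {d} := by
    rw [Subgroup.closure_le]
    rintro _ ⟨x, rfl⟩
    rw [SetLike.mem_coe, Subgroup.mem_centralizer_singleton_iff]
    have h2 := hfix _ (Subgroup.Normal.conj_mem ‹D.Normal› d hd x)
    rw [map_mul, map_mul, map_inv, hfix d hd] at h2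
    have h3 : φ x * d = x * d * x⁻¹ * φ x := by rw [← h2]; group
    calc x⁻¹ * φ x * d = x⁻¹ * (φ x * d) := by group
      _ = d * (x⁻¹ * φ x) := by rw [h3]; group
  rw [closure_inv_mul_eq_top_of_minimal hφ hφ1 hQ hmin, top_le_iff] at h1
  rw [Subgroup.mem_center_iff]
  intro g
  exact Subgroup.mem_centralizer_singleton_iff.1 (h1 ▸ Subgroup.mem_top g)

/-- If `φ` has order `p` and centralizes all proper invariant subgroups, it acts without nontrivial
fixed points on `Q ⧸ Z(Q)`, so `|Q : Z(Q)| ≡ 1 mod p`. -/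
theorem MulAut.card_quotient_center_modEq_one_of_minimal [Finite Q] [Fact p.Prime]
    (hc : commutator Q ≤ Subgroup.center Q)
    (hZ : Subgroup.center Q ≠ ⊤) : Nat.card (Q ⧸ Subgroup.center Q) ≡ 1 [MOD p] := by
  have hZfix := hmin _ hZ fun x hx =>
    (Subgroup.characteristic_iff_map_le.1 inferInstance φ : _ ≤ Subgroup.center Q) ⟨x, hx, rfl⟩
  let F : Subgroup Q := φ.toMonoidHom.eqLocus (MonoidHom.id Q)
  have hZF : Subgroup.center Q ≤ F := hZfix
  have hFn : F.Normal := Subgroup.Normal.of_commutator_le _ (hc.trans hZF)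
  have hFtop : F ≠ ⊤ := fun h => hφ1 (MulEquiv.ext fun x => (h ▸ Subgroup.mem_top x : x ∈ F))
  -- The fixed subgroup is proper, and normal because it contains the commutator subgroup; so it is
  -- central.
  have hFZ : F ≤ Subgroup.center Q :=
    le_center_of_minimal hφ hφ1 hQ hmin hFtop fun x hx => by
      have : φ x = x := hx
      rwa [this]
  let f : Function.End (Q ⧸ Subgroup.center Q) :=
    ⇑(QuotientGroup.map (Subgroup.center Q) (Subgroup.center Q) φ.toMonoidHom
      (Subgroup.characteristic_iff_le_comap.1 inferInstance φ))
  have hfmk : ∀ x : Q, f x = (φ x : Q) := fun x => rfl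
  have hpow : ∀ (n : ℕ) (x : Q), (f ^ n) (x : Q ⧸ Subgroup.center Q) = ((φ ^ n) x : Q) := by
    intro n
    induction n with
    | zero => intro x; rfl
    | succ n ih =>
      intro x
      rw [pow_succ', pow_succ', MulAut.mul_apply, ← hfmk, ← ih]
      rfl
  have hf : f ^ p ^ 1 = 1 := by
    funext x
    obtain ⟨x, rfl⟩ := QuotientGroup.mk_surjective x
    rw [pow_one, hpow, hφ]
    rfl
  have hf1 : f ((1 : Q) : Q ⧸ Subgroup.center Q) = (1 : Q) := by rw [hfmk, map_one]
  classical
  have := Fintype.ofFinite (Q ⧸ Subgroup.center Q)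
  have key := Equiv.Perm.card_fixedPoints_modEq hf
  rw [← Nat.card_eq_fintype_card] at key
  refine key.trans ?_
  rw [Fintype.card_eq_one_iff.2 ⟨⟨((1 : Q) : Q ⧸ Subgroup.center Q), hf1⟩, ?_⟩]
  · rintro ⟨y, hy⟩
    obtain ⟨x, rfl⟩ := QuotientGroup.mk_surjective y
    have hy' : ((φ x : Q) : Q ⧸ Subgroup.center Q) = x := hy
    have h1 : x⁻¹ * φ x ∈ Subgroup.center Q := QuotientGroup.eq.1 hy'.symm
    have h2 : φ x = x := apply_eq_self_of_fixed_inv_mul hφ hQ (hZfix _ h1)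
    have h3 : x ∈ Subgroup.center Q := hFZ h2
    exact Subtype.ext ((QuotientGroup.eq_one_iff x).2 h3)

end CoprimeAut

open Module
open scoped commutatorElement

/-! ### Irreducible representations and their degrees -/

section Irreducible

variable {k G V : Type*} [Field k] [Group G] [AddCommGroup V] [Module k V]

theorem Representation.IsIrreducible.eq_top_of_ne_bot {ρ : Representation k G V}
    (h : ρ.IsIrreducible) {W : Submodule k V} (hW : ∀ g, ∀ v ∈ W, ρ g v ∈ W) (hbot : W ≠ ⊥) :
    W = ⊤ := by
  have := h
  rcases eq_bot_or_eq_top (⟨W, hW⟩ : Subrepresentation ρ) with h | h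
  · exact absurd (congrArg Subrepresentation.toSubmodule h) hbot
  · exact congrArg Subrepresentation.toSubmodule h

theorem Representation.IsIrreducible.nontrivial {ρ : Representation k G V}
    (h : ρ.IsIrreducible) : Nontrivial V := by
  by_contra hV
  rw [not_nontrivial_iff_subsingleton] at hV
  obtain ⟨a, b, hab⟩ := h.toNontrivial
  exact hab (Subrepresentation.toSubmodule_injective (Subsingleton.elim _ _))

/-- **Burnside's theorem**: over an algebraically closed field the image of an irreducible
representation spans the endomorphism algebra. -/
theorem Representation.IsIrreducible.span_range_eq_top [IsAlgClosed k] [FiniteDimensional k V]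
    {ρ : Representation k G V} (h : ρ.IsIrreducible) :
    Submodule.span k (Set.range ρ) = ⊤ := by
  have := h
  rw [eq_top_iff]
  rintro f -
  -- By Schur's lemma the commutant is $k$, so every $k$-linear map lies in the bicommutant and the
  -- density theorem applies to it.
  let f' : End (End (MonoidAlgebra k G) ρ.asModule) ρ.asModule :=
    { toFun := fun v => ρ.asModuleEquiv.symm (f (ρ.asModuleEquiv v))
      map_add' := fun v w => by simp
      map_smul' := fun φ v => by
        obtain ⟨c, rfl⟩ := (IsSimpleModule.algebraMap_end_bijective_of_isAlgClosed
          (A := MonoidAlgebra k G) (V := ρ.asModule) k).2 φ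
        simp }
  classical
  let b := Module.finBasis k V
  obtain ⟨r, hr⟩ := jacobson_density f' (Finset.univ.image fun i => ρ.asModuleEquiv.symm (b i))
  have hfr : f = ρ.asAlgebraHom r := by
    refine b.ext fun i => ?_
    have := hr _ (Finset.mem_image_of_mem _ (Finset.mem_univ i))
    have h2 := congrArg ρ.asModuleEquiv this
    rw [ρ.asModuleEquiv_map_smul] at h2
    simpa [f'] using h2
  rw [hfr]
  have hspan : ∀ s, ρ.asAlgebraHom s ∈ Submodule.span k (Set.range ρ) := by
    intro s
    induction s using MonoidAlgebra.induction_linear with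
    | zero => rw [map_zero]; exact Submodule.zero_mem _
    | add x y hx hy => rw [map_add]; exact Submodule.add_mem _ hx hy
    | single g a =>
      rw [Representation.asAlgebraHom_single]
      exact Submodule.smul_mem _ _ (Submodule.subset_span ⟨g, rfl⟩)
  exact hspan r

theorem Representation.exists_irreducible_subrepresentation [FiniteDimensional k V]
    (ρ : Representation k G V) {W : Submodule k V} (hW : ∀ g, ∀ v ∈ W, ρ g v ∈ W) (hbot : W ≠ ⊥) :
    ∃ σ : Subrepresentation ρ, σ.toSubmodule ≤ W ∧ σ.toRepresentation.IsIrreducible := by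
  obtain ⟨U, ⟨hU, hUbot, hUW⟩, hmin⟩ := wellFounded_lt.has_min
    {U : Submodule k V | (∀ g, ∀ v ∈ U, ρ g v ∈ U) ∧ U ≠ ⊥ ∧ U ≤ W} ⟨W, hW, hbot, le_rfl⟩
  refine ⟨⟨U, hU⟩, hUW, { exists_pair_ne := ⟨⊥, ⊤, fun h => hUbot ?_⟩, eq_bot_or_eq_top := fun τ => ?_ }⟩
  · have h1 : (⊥ : Submodule k U) = ⊤ := congrArg Subrepresentation.toSubmodule h
    rw [Submodule.eq_bot_iff]
    intro x hx
    have : (⟨x, hx⟩ : U) ∈ (⊥ : Submodule k U) := h1 ▸ Submodule.mem_top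
    simpa using this
  · by_cases hτ : τ.toSubmodule = ⊥
    · exact .inl (Subrepresentation.toSubmodule_injective hτ)
    · right
      apply Subrepresentation.toSubmodule_injective
      change τ.toSubmodule = (⊤ : Submodule k U)
      have h1 : (τ.toSubmodule : Submodule k U).map U.subtype ≤ U := Submodule.map_subtype_le _ _
      have h2 := hmin ((τ.toSubmodule : Submodule k U).map U.subtype) ⟨?_, ?_, h1.trans hUW⟩
      · have h3 := eq_of_le_of_not_lt h1 h2
        rw [eq_top_iff]
        rintro ⟨x, hx⟩ -
        obtain ⟨y, hy, rfl⟩ := h3.ge hx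
        exact hy
      · rintro g _ ⟨v, hv, rfl⟩
        exact ⟨_, τ.apply_mem_toSubmodule g hv, rfl⟩
      · rw [Ne, ← Submodule.map_bot U.subtype]
        exact fun h => hτ (Submodule.map_injective_of_injective U.injective_subtype h)

theorem Representation.isSemisimple_apply [FiniteDimensional k V] [Finite G] {p : ℕ} [CharP k p]
    (ρ : Representation k G V) (hG : ¬ p ∣ Nat.card G) (g : G) :
    Module.End.IsSemisimple (ρ g) := by
  refine Module.End.isSemisimple_of_squarefree_aeval_eq_zero
    (p := (Polynomial.X ^ Nat.card G - Polynomial.C 1 : Polynomial k))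
    (Polynomial.separable_X_pow_sub_C' p _ 1 hG one_ne_zero).squarefree ?_
  rw [map_sub, map_pow, Polynomial.aeval_X, ← map_pow, pow_card_eq_one', map_one]
  simp

theorem Representation.IsIrreducible.exists_smul_of_mem_center [IsAlgClosed k]
    [FiniteDimensional k V] {ρ : Representation k G V} (h : ρ.IsIrreducible) {z : G}
    (hz : z ∈ Subgroup.center G) : ∃ c : k, ρ z = c • (1 : End k V) := by
  have := h.nontrivial
  obtain ⟨c, hc⟩ := Module.End.exists_eigenvalue (ρ z)
  refine ⟨c, ?_⟩
  have := h.eq_top_of_ne_bot (W := Module.End.eigenspace (ρ z) c) (fun g v hv => ?_) hc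
  · ext v
    have hv : v ∈ Module.End.eigenspace (ρ z) c := this ▸ Submodule.mem_top
    simpa using Module.End.mem_eigenspace_iff.1 hv
  · rw [Module.End.mem_eigenspace_iff] at hv ⊢
    rw [← Module.End.mul_apply, ← map_mul, ← Subgroup.mem_center_iff.1 hz g, map_mul,
      Module.End.mul_apply, hv, map_smul]

/-- An irreducible representation of a group of class two in which no noncentral element becomes
central has degree `m` with `m ^ 2 = |G : Z(G)|`. -/
theorem Representation.IsIrreducible.card_quotient_center [IsAlgClosed k]
    [FiniteDimensional k V] [Finite G] {ρ : Representation k G V} (h : ρ.IsIrreducible)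
    (hc : commutator G ≤ Subgroup.center G) (hdim : (finrank k V : k) ≠ 0)
    (hnd : ∀ x, (∀ y, ρ ⁅x, y⁆ = 1) → x ∈ Subgroup.center G) :
    Nat.card (G ⧸ Subgroup.center G) = finrank k V ^ 2 := by
  -- For noncentral $x$, some $\rho([x,y])$ is a scalar $c \ne 1$. Then $\rho(x)$ is $c$ times a
  -- conjugate of itself and has trace $0$. So coset representatives of the centre are independent
  -- under the trace form; by Burnside they span.
  have htr : ∀ x, x ∉ Subgroup.center G → LinearMap.trace k V (ρ x) = 0 := by
    intro x hx
    obtain ⟨y, hy⟩ := not_forall.1 (mt (hnd x) hx)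
    obtain ⟨c, hcc⟩ := h.exists_smul_of_mem_center
      (hc (Subgroup.commutator_mem_commutator (Subgroup.mem_top x) (Subgroup.mem_top y)))
    have h1 : ρ x = c • (ρ y * ρ x * ρ y⁻¹) := by
      have : x = ⁅x, y⁆ * (y * x * y⁻¹) := by rw [commutatorElement_def]; group
      conv_lhs => rw [this, map_mul, hcc, map_mul, map_mul]
      rw [smul_mul_assoc, one_mul]
    have h2 : LinearMap.trace k V (ρ x) = c * LinearMap.trace k V (ρ x) := by
      conv_lhs => rw [h1, map_smul, mul_assoc, LinearMap.trace_mul_comm, mul_assoc, ← map_mul,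
        inv_mul_cancel, map_one, mul_one]
      rfl
    have hc1 : c ≠ 1 := by
      rintro rfl
      exact hy (by rw [hcc, one_smul])
    have h3 : (1 - c) * LinearMap.trace k V (ρ x) = 0 := by rw [sub_mul, one_mul, ← h2, sub_self]
    exact (mul_eq_zero.1 h3).resolve_left (sub_ne_zero.2 hc1.symm)
  let Z := Subgroup.center G
  have := Fintype.ofFinite (G ⧸ Z)
  let v : G ⧸ Z → End k V := fun i => ρ i.out
  have hli : LinearIndependent k v := by
    rw [Fintype.linearIndependent_iff]
    intro a ha j
    have h1 := congrArg (fun f => LinearMap.trace k V (ρ j.out⁻¹ * f)) ha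
    simp only [Finset.mul_sum, mul_smul_comm, map_sum, map_smul, mul_zero, map_zero, v,
      ← map_mul] at h1
    rw [Finset.sum_eq_single j] at h1
    · rw [inv_mul_cancel, map_one, LinearMap.trace_one, smul_eq_mul] at h1
      exact (mul_eq_zero.1 h1).resolve_right hdim
    · intro i _ hij
      rw [htr, smul_zero]
      intro hmem
      refine hij ?_
      rw [← QuotientGroup.out_eq' i, ← QuotientGroup.out_eq' j]
      exact (QuotientGroup.eq.2 hmem).symm
    · simp
  have hsp : ⊤ ≤ Submodule.span k (Set.range v) := by
    rw [← h.span_range_eq_top, Submodule.span_le]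
    rintro _ ⟨x, rfl⟩
    have hz : ((x : G ⧸ Z).out)⁻¹ * x ∈ Z := QuotientGroup.eq.1 (QuotientGroup.out_eq' (x : G ⧸ Z))
    obtain ⟨c, hc⟩ := h.exists_smul_of_mem_center hz
    have : ρ x = c • v x := by
      have h1 : x = (x : G ⧸ Z).out * (((x : G ⧸ Z).out)⁻¹ * x) := by group
      conv_lhs => rw [h1, map_mul, hc, mul_smul_comm, mul_one]
    rw [this]
    exact Submodule.smul_mem _ _ (Submodule.subset_span ⟨_, rfl⟩)
  rw [Nat.card_eq_fintype_card, ← Module.finrank_eq_card_basis (Basis.mk hli hsp),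
    Module.finrank_linearMap, sq]

/-- An automorphism of order `p` of an abelian linear group of degree less than `p` and order prime
to `p` that is induced by a linear map is trivial. -/
theorem Representation.mulAut_eq_one_of_comm [IsAlgClosed k] [FiniteDimensional k V] [Finite G]
    {p : ℕ} [Fact p.Prime] [CharP k p] {ρ : Representation k G V} (hρ : Function.Injective ρ)
    (hG : ¬ p ∣ Nat.card G) (hcomm : ∀ x y : G, x * y = y * x) (hdim : finrank k V < p)
    {φ : MulAut G} (hφ : φ ^ p = 1) {T : End k V} (hT : Function.Injective T)
    (hTρ : ∀ x v, T (ρ x v) = ρ (φ x) (T v)) : φ = 1 := by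
  have hp : p.Prime := Fact.out
  let W : (G → k) → Submodule k V := fun χ => ⨅ x, Module.End.maxGenEigenspace (ρ x) (χ x)
  have hcom : ∀ x y, Commute (ρ x) (ρ y) := fun x y => by
    rw [commute_iff_eq, ← map_mul, hcomm, map_mul]
  have hmem : ∀ χ v, v ∈ W χ ↔ ∀ x, ρ x v = χ x • v := by
    intro χ v
    simp only [W, Submodule.mem_iInf]
    refine forall_congr' fun x => ?_
    rw [(ρ.isSemisimple_apply hG x).isFinitelySemisimple.maxGenEigenspace_eq_eigenspace,
      Module.End.mem_eigenspace_iff]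
  have htop : ⨆ χ, W χ = ⊤ :=
    Module.End.iSup_iInf_maxGenEigenspace_eq_top_of_iSup_maxGenEigenspace_eq_top_of_commute _
      (fun i j _ => hcom i j) fun i => Module.End.iSup_maxGenEigenspace_eq_top _
  have hind : iSupIndep W := Module.End.independent_iInf_maxGenEigenspace_of_forall_mapsTo _
    fun i j c => Module.End.mapsTo_maxGenEigenspace_of_comm (hcom j i) c
  let S := {χ : G → k // W χ ≠ ⊥}
  have : Fintype S := hind.fintypeNeBotOfFiniteDimensional
  have hS : Fintype.card S ≤ finrank k V := hind.subtype_ne_bot_le_finrank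
  -- $T$ permutes the simultaneous eigenspaces, as $\varphi$ permutes the characters.
  have hmap : ∀ χ, W χ ≠ ⊥ → W (χ ∘ φ.symm) ≠ ⊥ := by
    intro χ hχ
    obtain ⟨v, hv, hv0⟩ := Submodule.exists_mem_ne_zero_of_ne_bot hχ
    refine (Submodule.ne_bot_iff _).2 ⟨T v, ?_, fun h => hv0 (hT (by rw [h, map_zero]))⟩
    rw [hmem] at hv ⊢
    intro x
    have := hTρ (φ.symm x) v
    rwa [hv, map_smul, MulEquiv.apply_symm_apply, eq_comm] at this
  let f : S → S := fun χ => ⟨χ.1 ∘ φ.symm, hmap χ.1 χ.2⟩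
  have hf : Function.Injective f := by
    intro χ ψ h
    refine Subtype.ext (funext fun x => ?_)
    simpa [f] using congrFun (congrArg Subtype.val h) (φ x)
  let σ : Equiv.Perm S := Equiv.ofBijective f (Finite.injective_iff_bijective.1 hf)
  have hσn : ∀ (n : ℕ) (χ : S) (x : G), ((σ ^ n) χ).1 ((φ ^ n) x) = χ.1 x := by
    intro n
    induction n with
    | zero => intro χ x; rfl
    | succ n ih =>
      intro χ x
      rw [pow_succ', pow_succ', Equiv.Perm.mul_apply, MulAut.mul_apply, ← ih χ x]
      change ((σ ^ n) χ).1 (φ.symm (φ _)) = _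
      rw [MulEquiv.symm_apply_apply]
  have hσp : σ ^ p = 1 := by
    ext χ x
    have := hσn p χ x
    rw [hφ] at this
    exact this
  have hσ : σ = 1 := by
    classical
    rw [← orderOf_eq_one_iff]
    -- A permutation of order $p$ needs at least $p$ points, but at most $\dim V < p$ characters
    -- occur.
    refine ((Nat.dvd_prime hp).1 (orderOf_dvd_of_pow_eq_one hσp)).resolve_right fun ho => ?_
    have h1 := orderOf_dvd_card (x := σ)
    rw [ho, Fintype.card_perm, hp.dvd_factorial] at h1
    exact absurd (h1.trans hS) hdim.not_ge
  ext x
  refine hρ (LinearMap.ext fun v => ?_)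
  have hle : ⨆ χ, W χ ≤ LinearMap.eqLocus (ρ (φ x)) (ρ x) := by
    refine iSup_le fun χ => ?_
    by_cases hχ : W χ = ⊥
    · rw [hχ]; exact bot_le
    · intro v hv
      rw [hmem] at hv
      have := hσn 1 ⟨χ, hχ⟩ x
      rw [hσ] at this
      rw [LinearMap.mem_eqLocus, hv, hv]
      congr 1
  exact hle (htop ▸ Submodule.mem_top)

end Irreducible

/-! ### An element of order $p$ acting on a linear $p'$-group -/

section CoprimeAction

variable {k V : Type*} [Field k] [IsAlgClosed k] [AddCommGroup V] [Module k V]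
  [FiniteDimensional k V] {p : ℕ} [Fact p.Prime] [CharP k p]

/-- $T$ serves only to exclude abelian $Q$. The rest compares $|Q:Z(Q)| \equiv 1 \pmod p$ with
$|Q:Z(Q)| = m^2$ for a constituent of degree $m$. -/
theorem Representation.exists_prime_pow_add_one_of_minimal {Q : Type*} [Group Q] [Finite Q]
    {ρ : Representation k Q V} (hρ : Function.Injective ρ) (hQ : (Nat.card Q).Coprime p)
    (hdim : finrank k V < p) {φ : MulAut Q} (hφ : φ ^ p = 1) (hφ1 : φ ≠ 1)
    {T : End k V} (hT : Function.Injective T) (hTρ : ∀ x v, T (ρ x v) = ρ (φ x) (T v))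
    (hmin : ∀ H : Subgroup Q, H ≠ ⊤ → (∀ x ∈ H, φ x ∈ H) → ∀ x ∈ H, φ x = x) :
    ∃ q n : ℕ, q.Prime ∧ p = q ^ n + 1 ∧ q ^ n ≤ finrank k V ∧ 1 < q ^ n := by
  have hp : p.Prime := Fact.out
  have hpQ : ¬ p ∣ Nat.card Q := hp.coprime_iff_not_dvd.1 hQ.symm
  have hncomm : ¬ ∀ x y : Q, x * y = y * x := fun h =>
    hφ1 (mulAut_eq_one_of_comm hρ hpQ h hdim hφ hT hTρ)
  have hZ : Subgroup.center Q ≠ ⊤ := fun h => hncomm fun x y =>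
    Subgroup.mem_center_iff.1 (h ▸ Subgroup.mem_top y : y ∈ Subgroup.center Q) x
  obtain ⟨q, hq, hQq⟩ := MulAut.exists_isPGroup_of_minimal hφ hφ1 hQ hmin
  have := Fact.mk hq
  have hnt : Nontrivial Q := by
    by_contra h
    rw [not_nontrivial_iff_subsingleton] at h
    exact hncomm fun x y => Subsingleton.elim _ _
  have hnil : Group.IsNilpotent Q := hQq.isNilpotent
  have hctop : commutator Q ≠ ⊤ := (Group.IsSolvable.commutator_lt_top_of_nontrivial Q).ne
  have hcinv : ∀ x ∈ commutator Q, φ x ∈ commutator Q := fun x hx =>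
    (Subgroup.characteristic_iff_map_le.1 inferInstance φ : _ ≤ commutator Q) ⟨x, hx, rfl⟩
  have hc : commutator Q ≤ Subgroup.center Q :=
    MulAut.le_center_of_minimal hφ hφ1 hQ hmin hctop hcinv
  have hcfix := hmin _ hctop hcinv
  have hcm : ∀ x y : Q, ⁅x, y⁆ ∈ commutator Q := fun x y =>
    Subgroup.commutator_mem_commutator (Subgroup.mem_top x) (Subgroup.mem_top y)
  obtain ⟨a, b, hab⟩ : ∃ a b : Q, ⁅a, b⁆ ≠ 1 := by
    by_contra! h
    exact hncomm fun x y => commutatorElement_eq_one_iff_mul_comm.1 (h x y)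
  -- Taking $\mu \ne 1$ ensures that the central element $[a,b]$ stays nontrivial on the chosen
  -- constituent.
  obtain ⟨μ, hμ1, hμ⟩ : ∃ μ : k, μ ≠ 1 ∧ Module.End.eigenspace (ρ ⁅a, b⁆) μ ≠ ⊥ := by
    by_contra! h
    have h1 := (ρ.isSemisimple_apply hpQ ⁅a, b⁆).iSup_eigenspace_eq_top
    have h2 : Module.End.eigenspace (ρ ⁅a, b⁆) 1 = ⊤ := by
      rw [eq_top_iff, ← h1]
      refine iSup_le fun μ => ?_
      rcases eq_or_ne μ 1 with rfl | hμ
      · exact le_rfl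
      · rw [h μ hμ]; exact bot_le
    refine hab (hρ (LinearMap.ext fun v => ?_))
    have h3 : v ∈ Module.End.eigenspace (ρ ⁅a, b⁆) 1 := h2 ▸ Submodule.mem_top
    simpa using Module.End.mem_eigenspace_iff.1 h3
  obtain ⟨σ, hσ, hirr⟩ := ρ.exists_irreducible_subrepresentation
    (W := Module.End.eigenspace (ρ ⁅a, b⁆) μ) (fun g v hv => by
      rw [Module.End.mem_eigenspace_iff] at hv ⊢
      rw [← Module.End.mul_apply, ← map_mul, ← Subgroup.mem_center_iff.1 (hc (hcm a b)) g, map_mul,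
        Module.End.mul_apply, hv, map_smul]) hμ
  set τ := σ.toRepresentation with hτ
  have hnU := hirr.nontrivial
  have hτab : τ ⁅a, b⁆ ≠ 1 := by
    intro h
    obtain ⟨u, hu⟩ := exists_ne (0 : σ.toSubmodule)
    have h1 : (ρ ⁅a, b⁆ u : V) = u := congrArg Subtype.val (LinearMap.congr_fun h u)
    rw [Module.End.mem_eigenspace_iff.1 (hσ u.2)] at h1
    have h2 : (μ - 1) • (u : V) = 0 := by rw [sub_smul, one_smul, h1, sub_self]
    rcases smul_eq_zero.1 h2 with h3 | h3
    · exact hμ1 (sub_eq_zero.1 h3)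
    · exact hu (Subtype.ext h3)
  have hiff : ∀ x y, τ ⁅x, y⁆ = 1 ↔ τ x * τ y = τ y * τ x := by
    intro x y
    constructor
    · intro h
      rw [← map_mul, ← map_mul, show x * y = ⁅x, y⁆ * (y * x) by rw [commutatorElement_def]; group,
        map_mul, h, one_mul]
    · intro h
      rw [commutatorElement_def, map_mul, map_mul, map_mul, h, ← map_mul, ← map_mul, ← map_mul,
        ← map_one τ]
      congr 1
      group
  -- $L$ is the preimage of the centre of $\tau(Q)$. It is invariant since $\varphi$ fixes
  -- commutators, and proper since $\tau([a,b]) \ne 1$; minimality gives $L = Z(Q)$, the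
  -- nondegeneracy needed for the degree formula.
  let L : Subgroup Q :=
    { carrier := {x | ∀ y, τ x * τ y = τ y * τ x}
      one_mem' := fun y => by rw [map_one, one_mul, mul_one]
      mul_mem' := fun {x x'} hx hx' y => by
        rw [map_mul, mul_assoc, hx' y, ← mul_assoc, hx y, mul_assoc]
      inv_mem' := fun {x} hx y => by
        have := hx (x⁻¹ * y * x⁻¹)
        rw [← map_mul, ← map_mul] at this
        rw [← map_mul, ← map_mul]
        simpa [mul_assoc] using this.symm }
  have hZL : Subgroup.center Q ≤ L := fun x hx y => by
    rw [← map_mul, ← map_mul, Subgroup.mem_center_iff.1 hx y]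
  have hLn : L.Normal := Subgroup.Normal.of_commutator_le _ (hc.trans hZL)
  have hLtop : L ≠ ⊤ := fun h =>
    hτab ((hiff a b).2 ((h ▸ Subgroup.mem_top a : a ∈ L) b))
  have hLinv : ∀ x ∈ L, φ x ∈ L := by
    intro x hx y
    rw [← hiff, ← φ.apply_symm_apply y, ← map_commutatorElement, hcfix _ (hcm _ _), hiff]
    exact hx _
  have hLZ : L ≤ Subgroup.center Q := MulAut.le_center_of_minimal hφ hφ1 hQ hmin hLtop hLinv
  set m := finrank k σ.toSubmodule with hm
  have hmV : m ≤ finrank k V := Submodule.finrank_le _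
  have hm0 : 0 < m := finrank_pos
  have hcard : Nat.card (Q ⧸ Subgroup.center Q) = m ^ 2 := by
    refine hirr.card_quotient_center hc ?_ fun x hx => hLZ fun y => (hiff x y).1 (hx y)
    rw [Ne, CharP.cast_eq_zero_iff k p]
    exact fun h => absurd (Nat.le_of_dvd hm0 h) (hmV.trans_lt hdim).not_ge
  have hmod := MulAut.card_quotient_center_modEq_one_of_minimal hφ hφ1 hQ hmin hc hZ
  rw [hcard] at hmod
  have hm1 : m ≠ 1 := by
    intro h
    rw [h, one_pow] at hcard
    exact hZ (Subgroup.index_eq_one.1 hcard)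
  obtain ⟨e, he⟩ := (IsPGroup.iff_card (p := q)).1 (hQq.to_quotient (Subgroup.center Q))
  obtain ⟨n, -, hn⟩ := (Nat.dvd_prime_pow hq).1 (he ▸ hcard ▸ Dvd.intro_left (m ^ 1) (by ring) :
    m ∣ q ^ e)
  have hpm : p = m + 1 := by
    -- As $1 < m < p$, the prime $p$ cannot divide $m - 1$, and dividing $m + 1$ forces equality.
    have h1 : (p : ℤ) ∣ (m - 1) * (m + 1) := by
      have := (Nat.modEq_iff_dvd.1 hmod.symm)
      push_cast at this
      convert this using 1
      ring
    rcases (Nat.prime_iff_prime_int.1 hp).dvd_or_dvd h1 with h2 | h2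
    · have := Int.le_of_dvd (by omega) h2
      omega
    · have := Int.le_of_dvd (by omega) h2
      omega
  exact ⟨q, n, hq, by rw [← hn, hpm], hn ▸ hmV, by omega⟩

/-- If a linear map of order `p` normalizes, but does not centralize, a linear `p'`-group of degree
less than `p`, then `p - 1` is a nontrivial prime power, and is at most the degree. -/
theorem Representation.exists_prime_pow_add_one : ∀ (N : ℕ) {Q : Type*} [Group Q] [Finite Q]
    {ρ : Representation k Q V}, Nat.card Q = N → Function.Injective ρ → (Nat.card Q).Coprime p →
    finrank k V < p → ∀ {φ : MulAut Q}, φ ^ p = 1 → φ ≠ 1 →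
    ∀ {T : End k V}, Function.Injective T → (∀ x v, T (ρ x v) = ρ (φ x) (T v)) →
    ∃ q n : ℕ, q.Prime ∧ p = q ^ n + 1 ∧ q ^ n ≤ finrank k V ∧ 1 < q ^ n := by
  intro N
  induction N using Nat.strong_induction_on with
  | _ N ih =>
  intro Q _ _ ρ hN hρ hQ hdim φ hφ hφ1 T hT hTρ
  by_cases hmin : ∀ H : Subgroup Q, H ≠ ⊤ → (∀ x ∈ H, φ x ∈ H) → ∀ x ∈ H, φ x = x
  · exact exists_prime_pow_add_one_of_minimal hρ hQ hdim hφ hφ1 hT hTρ hmin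
  push Not at hmin
  -- Descend to a proper invariant subgroup on which $\varphi$ is still nontrivial.
  obtain ⟨H, hH, hinv, x, hx, hne⟩ := hmin
  let f : H →* H := (φ.toMonoidHom.comp H.subtype).codRestrict H fun y => hinv y y.2
  have hf : Function.Injective f := fun y z h =>
    Subtype.ext (φ.injective (congrArg Subtype.val h))
  let ψ : MulAut H := MulEquiv.ofBijective f (Finite.injective_iff_bijective.1 hf)
  have hψ : ∀ (n : ℕ) (y : H), (((ψ ^ n) y : H) : Q) = (φ ^ n) y := by
    intro n
    induction n with
    | zero => intro y; rfl
    | succ n ih =>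
      intro y
      rw [pow_succ', pow_succ', MulAut.mul_apply, MulAut.mul_apply, ← ih]
      rfl
  refine ih (Nat.card H) ?_ (ρ := ρ.comp H.subtype) rfl (hρ.comp H.subtype_injective)
    (hQ.coprime_dvd_left H.card_subgroup_dvd_card) hdim (φ := ψ) ?_ ?_ hT fun y v => hTρ y v
  · rw [← hN]
    exact lt_of_le_of_ne (Subgroup.card_le_card_group H)
      fun he => hH (Subgroup.eq_top_of_card_eq _ he)
  · ext y
    rw [hψ, hφ]
    rfl
  · intro h
    refine hne ?_
    have := congrArg Subtype.val (DFunLike.congr_fun h (⟨x, hx⟩ : H))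
    exact this

end CoprimeAction

-- Vanishing cohomology, fixed vectors and the conclusion

universe w

/-- Averaging the cocycle identity over $h$ exhibits $f$ as the coboundary of minus the mean of $f$.
-/
theorem groupCohomology.subsingleton_H1_of_invertible {k G : Type w} [Field k] [Group G] [Finite G]
    (hG : (Nat.card G : k) ≠ 0) (A : Rep.{w} k G) : Subsingleton (groupCohomology.H1 A) := by
  have := Fintype.ofFinite G
  refine subsingleton_of_forall_eq 0 fun x => ?_
  induction x using groupCohomology.H1_induction_on with
  | h f =>
  rw [groupCohomology.H1π_eq_zero_iff]
  refine ⟨-((Nat.card G : k)⁻¹ • ∑ h, f h), funext fun g => ?_⟩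
  have h1 : ∑ h, f (g * h) = ∑ h, f h :=
    Fintype.sum_bijective (g * ·) (Group.mulLeft_bijective g) _ _ fun _ => rfl
  have h2 : ∀ h, f (g * h) = A.ρ g (f h) + f g :=
    fun h => (groupCohomology.mem_cocycles₁_iff (A := A) f).1 f.2 g h
  simp only [h2, Finset.sum_add_distrib, Finset.sum_const, Finset.card_univ, ← map_sum] at h1
  have h3 : (Nat.card G : k) • f g = ∑ h, f h - A.ρ g (∑ h, f h) := by
    rw [eq_sub_iff_add_eq', Nat.card_eq_fintype_card, Nat.cast_smul_eq_nsmul]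
    exact h1
  rw [groupCohomology.d₀₁_hom_apply, map_neg, map_smul, sub_neg_eq_add, neg_add_eq_sub, ← smul_sub,
    ← h3, inv_smul_smul₀ hG]

/-- A `p`-group acting linearly on a nonzero space of characteristic `p` has a nonzero fixed
vector. -/
theorem IsPGroup.exists_ne_zero_fixed {p : ℕ} [Fact p.Prime] {k P V : Type*} [Field k] [CharP k p]
    [Group P] [Finite P] [AddCommGroup V] [Module k V] [Nontrivial V] (hP : IsPGroup p P)
    (ρ : Representation k P V) : ∃ v : V, v ≠ 0 ∧ ∀ g, ρ g v = v := by
  obtain ⟨v, hv⟩ := exists_ne (0 : V)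
  let : Algebra (ZMod p) k := ZMod.algebra k p
  let : Module (ZMod p) V := Module.compHom V (algebraMap (ZMod p) k)
  have htower : IsScalarTower (ZMod p) k V := ⟨fun a b v => by
    rw [Algebra.smul_def, mul_smul]; rfl⟩
  -- The $\mathbb F_p$-span of one orbit is a finite invariant set, so fixed points can be counted
  -- modulo $p$ even when $k$ is infinite.
  let M : Submodule (ZMod p) V := Submodule.span (ZMod p) (Set.range fun g => ρ g v)
  have hM : ∀ g, ∀ w ∈ M, ρ g w ∈ M := by
    intro g w hw
    have h1 : M ≤ M.comap ((ρ g).restrictScalars (ZMod p)) := by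
      rw [Submodule.span_le]
      rintro _ ⟨h, rfl⟩
      exact Submodule.subset_span ⟨g * h, by simp⟩
    exact h1 hw
  have : Module.Finite (ZMod p) M := Module.Finite.span_of_finite _ (Set.finite_range _)
  have : Finite M := Module.finite_of_finite (ZMod p)
  let : MulAction P M :=
    { smul := fun g w => ⟨ρ g w, hM g w w.2⟩
      one_smul := fun w => Subtype.ext (by change ρ 1 (w : V) = w; simp)
      mul_smul := fun g h w => Subtype.ext (by change ρ (g * h) (w : V) = ρ g (ρ h w); simp) }
  have hvM : v ∈ M := Submodule.subset_span ⟨1, by simp⟩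
  have hpM : p ∣ Nat.card M := by
    have h1 : addOrderOf (⟨v, hvM⟩ : M) = p := by
      refine addOrderOf_eq_prime ?_ fun h => hv (congrArg Subtype.val h)
      rw [← Nat.cast_smul_eq_nsmul (ZMod p), CharP.cast_eq_zero, zero_smul]
    have h2 := addOrderOf_dvd_natCard (⟨v, hvM⟩ : M)
    rwa [h1] at h2
  have h0 : (0 : M) ∈ MulAction.fixedPoints P M := fun g => Subtype.ext (map_zero (ρ g))
  obtain ⟨w, hw, hw0⟩ := hP.exists_fixed_point_of_prime_dvd_card_of_fixed_point M hpM h0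
  exact ⟨w, fun h => hw0 (Subtype.ext h.symm), fun g => congrArg Subtype.val (hw g)⟩

/-- The fixed vectors of a normal subgroup form a subrepresentation, here nonzero and therefore
everything. -/
theorem Representation.IsIrreducible.eq_bot_of_isPGroup {p : ℕ} [Fact p.Prime] {k G V : Type*}
    [Field k] [CharP k p] [Group G] [Finite G] [AddCommGroup V] [Module k V]
    {ρ : Representation k G V} (h : ρ.IsIrreducible) (hρ : Function.Injective ρ)
    (P : Subgroup G) [hPn : P.Normal] (hP : IsPGroup p P) : P = ⊥ := by
  have := h.nontrivial
  obtain ⟨v, hv0, hv⟩ := hP.exists_ne_zero_fixed (ρ.comp P.subtype)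
  let W : Submodule k V := ⨅ x : P, LinearMap.eqLocus (ρ x) LinearMap.id
  have hmem : ∀ w, w ∈ W ↔ ∀ x ∈ P, ρ x w = w := by simp [W]
  have hW := h.eq_top_of_ne_bot (W := W) (fun g w hw => ?_)
    ((Submodule.ne_bot_iff _).2 ⟨v, (hmem v).2 fun x hx => hv ⟨x, hx⟩, hv0⟩)
  · rw [Subgroup.eq_bot_iff_forall]
    refine fun x hx => hρ (LinearMap.ext fun w => ?_)
    rw [map_one]
    exact (hmem w).1 (hW ▸ Submodule.mem_top) x hx
  · rw [hmem] at hw ⊢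
    intro x hx
    have h1 := hw _ (hPn.conj_mem' x hx g)
    have h2 : ρ x (ρ g w) = ρ g (ρ (g⁻¹ * x * g) w) := by
      rw [← Module.End.mul_apply, ← map_mul, ← Module.End.mul_apply, ← map_mul]
      congr 2
      group
    rw [h2, h1]

/-- If a `p`-solvable group of order divisible by `p` has a faithful irreducible representation of
degree less than `p` in characteristic `p`, then `p - 1` is a nontrivial prime power, and is at most
the degree. -/
theorem Representation.IsIrreducible.exists_prime_pow_add_one {p : ℕ} [Fact p.Prime] {k G V : Type*}
    [Field k] [IsAlgClosed k] [CharP k p] [Group G] [Finite G] [AddCommGroup V] [Module k V]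
    [FiniteDimensional k V] {ρ : Representation k G V} (h : ρ.IsIrreducible)
    (hρ : Function.Injective ρ) (hG : IsPSolvable p G) (hdim : finrank k V < p)
    (hpG : p ∣ Nat.card G) :
    ∃ q n : ℕ, q.Prime ∧ p = q ^ n + 1 ∧ q ^ n ≤ finrank k V ∧ 1 < q ^ n := by
  obtain ⟨N, hN, hNp, hC⟩ := hG.exists_normal_not_dvd_card_centralizer
    fun P _ hP => h.eq_bot_of_isPGroup hρ P hP
  obtain ⟨g, hg⟩ := exists_prime_orderOf_dvd_card' p hpG
  have hgC : g ∉ Subgroup.centralizer (N : Set G) := fun hgC => hC <| by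
    rw [← hg, ← Subgroup.orderOf_mk g hgC]
    exact orderOf_dvd_natCard _
  refine Representation.exists_prime_pow_add_one (p := p) _ (ρ := ρ.comp N.subtype) rfl
    (hρ.comp N.subtype_injective) hNp hdim (φ := MulAut.conjNormal g) ?_ ?_ (T := ρ g) ?_ ?_
  · rw [← map_pow, ← hg, pow_orderOf_eq_one, map_one]
  · intro h1
    refine hgC (Subgroup.mem_centralizer_iff.2 fun x hx => ?_)
    have h2 := congrArg Subtype.val (DFunLike.congr_fun h1 (⟨x, hx⟩ : N))
    rw [MulAut.conjNormal_apply] at h2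
    exact (mul_inv_eq_iff_eq_mul.1 h2).symm
  · intro v w hvw
    have := congrArg (ρ g⁻¹) hvw
    simpa using this
  · intro x v
    change ρ g (ρ x v) = ρ (MulAut.conjNormal g x : N) (ρ g v)
    rw [MulAut.conjNormal_apply, ← Module.End.mul_apply, ← map_mul, ← Module.End.mul_apply,
      ← map_mul, inv_mul_cancel_right]

theorem Representation.IsIrreducible.isAdequate_of_not_dvd_card {p : ℕ} {k G V : Type w}
    [Field k] [IsAlgClosed k] [CharP k p] [Group G] [Finite G] [AddCommGroup V] [Module k V]
    [FiniteDimensional k V] {ρ : Representation k G V} (h : ρ.IsIrreducible)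
    (hdim : finrank k V < p) (hpG : ¬ p ∣ Nat.card G) : ρ.IsAdequate p where
  H1_trivial := groupCohomology.subsingleton_H1_of_invertible
    (by rwa [Ne, CharP.cast_eq_zero_iff k p]) _
  not_dvd_finrank := fun hd => by
    have := h.nontrivial
    exact absurd (Nat.le_of_dvd finrank_pos hd) hdim.not_ge
  H1_tprod_dual := groupCohomology.subsingleton_H1_of_invertible
    (by rwa [Ne, CharP.cast_eq_zero_iff k p]) _
  span_semisimple := by
    rw [eq_top_iff, ← h.span_range_eq_top]
    refine Submodule.span_mono ?_
    rintro _ ⟨g, rfl⟩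
    exact ⟨ρ.isSemisimple_apply hpG g, g, rfl⟩

theorem Nat.exists_eq_fermatNumber_of_eq_prime_pow_add_one {p q n : ℕ} (hp : p.Prime)
    (hq : q.Prime) (hpq : p = q ^ n + 1) (hlt : 1 < q ^ n) : ∃ m, p = Nat.fermatNumber m := by
  have hn : n ≠ 0 := by
    rintro rfl
    simp at hlt
  -- Primality of $q^n + 1$ forces $n$ to be a power of $2$; an odd $q$ would make $p$ even, so $p =
  -- 2$ and $q^n = 1$.
  obtain ⟨m, rfl⟩ := Nat.pow_of_pow_add_prime hq.one_lt hn (hpq ▸ hp)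
  have hq2 : q = 2 := by
    rcases hq.eq_two_or_odd' with h | h
    · exact h
    · have h1 : Even p := hpq ▸ (h.pow.add_one)
      have h2 := (hp.even_iff).1 h1
      omega
  exact ⟨m, by rw [hpq, hq2, Nat.fermatNumber]⟩

theorem theorem1p7 (p : ℕ) [Fact p.Prime] {k G V : Type u} [Field k] [IsAlgClosed k] [CharP k p]
    [Group G] [Finite G] [AddCommGroup V] [Module k V] [FiniteDimensional k V]
    (hG : IsPSolvable p G) (ρ : Representation k G V) (hfaithful : Function.Injective ρ)
    (hirr : ρ.IsIrreducible)
    (hp : (Module.finrank k V < p ∧ ¬ ∃ m : ℕ, p = Nat.fermatNumber m) ∨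
      Module.finrank k V + 1 < p) :
    ρ.IsAdequate p ∧ ¬ p ∣ Nat.card G := by
  have hdim : finrank k V < p := by
    rcases hp with hp | hp
    · exact hp.1
    · omega
  have hpG : ¬ p ∣ Nat.card G := by
    intro hpG
    obtain ⟨q, n, hq, hpq, hle, hlt⟩ := hirr.exists_prime_pow_add_one hfaithful hG hdim hpG
    rcases hp with hp | hp
    · exact hp.2 (Nat.exists_eq_fermatNumber_of_eq_prime_pow_add_one Fact.out hq hpq hlt)
    · omega
  exact ⟨hirr.isAdequate_of_not_dvd_card hdim hpG, hpG⟩
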